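/- Assume that there are no measurable cardinals, where a cardinal $\kappa$ is called measurable if it is uncountable and a set $I$ of cardinality $\kappa$ carries a countably additive $\{0,1\}$-valued measure $\mu$, defined on all subsets of $I$, with $\mu(I)=1$ and $\mu(\{x\})=0$ for all $x\in I$. (This assumption holds, for instance, if $V=L$.) Let $R$ be a unital ring and let $M$ be a right $R$-module. Let $\mathrm{Add}(M)$ (respectively $\mathrm{Prod}(M)$) denote the class of all right $R$-modules that are isomorphic to a direct summand of a direct sum $M^{(I)}$ (respectively of a direct product $M^{I}$) of copies of $M$, for some set $I$. Then the following are equivalent: 1. $\mathrm{Add}(M)\subseteq\mathrm{Prod}(M)$; 2. $M$ is $\Sigma$-pure injective, i.e. for every set $I$ the direct sum $M^{(I)}$ is pure injective. Here a right $R$-module $N$ is pure injective if for every pure monomorphism $f:A\to B$ of right $R$-modules and every homomorphism $g:A\to N$ there is a homomorphism $h:B\to N$ with $hf=g$. A monomorphism $f:A\to B$ of right $R$-modules is pure if every finite system of linear equations $\sum_{j=1}^n x_j r_{ij}=a_i$ $(1\le i\le m)$ with $r_{ij}\in R$ and $a_i\in A$, for which $\sum_{j=1}^n y_j r_{ij}=f(a_i)$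 $(1\le i\le m)$ has a solution in $B$, already has a solution in $A$. -/

import Mathlib

universe u

/-- A cardinal `κ` is measurable if it is uncountable and a set `I` of cardinality `κ` carries a
countably additive `{0, 1}`-valued measure, defined on all subsets of `I` (the σ-algebra `⊤`), with
`μ I = 1` and `μ {x} = 0` for all `x`. -/
def IsMeasurableCardinal (κ : Cardinal.{u}) : Prop :=
  Cardinal.aleph0 < κ ∧ ∃ I : Type u, Cardinal.mk I = κ ∧
    ∃ μ : @MeasureTheory.Measure I ⊤,
      (∀ s : Set I, μ s = 0 ∨ μ s = 1) ∧ μ Set.univ = 1 ∧ ∀ x : I, μ {x} = 0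

section Modules

variable (S : Type u) [Ring S]

/-- `N` is (isomorphic to) a direct summand of `X`. -/
def IsDirectSummand (N X : Type u) [AddCommGroup N] [Module S N]
    [AddCommGroup X] [Module S X] : Prop :=
  ∃ A B : Submodule S X, IsCompl A B ∧ Nonempty (N ≃ₗ[S] A)

/-- `Add(M)`: the class of all direct summands of direct sums `M^(I)` of copies of `M`. -/
def addClass (M : Type u) [AddCommGroup M] [Module S M] : Set (ModuleCat.{u} S) :=
  {N | ∃ I : Type u, IsDirectSummand S N (I →₀ M)}

/-- `Prod(M)`: the class of all direct summands of direct products `M^I` of copies of `M`. -/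
def prodClass (M : Type u) [AddCommGroup M] [Module S M] : Set (ModuleCat.{u} S) :=
  {N | ∃ I : Type u, IsDirectSummand S N (I → M)}

variable {S} in
/-- An `S`-linear map `f : A → B` is a pure monomorphism if it is injective and every finite system
of linear equations with coefficients in `S` and constants in `A` that is solvable in `B`
(after applying `f` to the constants) is already solvable in `A`. -/
def IsPureMono {A B : Type u} [AddCommGroup A] [Module S A] [AddCommGroup B] [Module S B]
    (f : A →ₗ[S] B) : Prop :=
  Function.Injective f ∧
    ∀ (m n : ℕ) (c : Matrix (Fin m) (Fin n) S) (a : Fin m → A),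
      (∃ y : Fin n → B, ∀ i, ∑ j, c i j • y j = f (a i)) →
        ∃ x : Fin n → A, ∀ i, ∑ j, c i j • x j = a i

/-- `M` is pure injective: every homomorphism into `M` extends along every pure monomorphism. -/
def IsPureInjective (M : Type u) [AddCommGroup M] [Module S M] : Prop :=
  ∀ (A B : Type u) [AddCommGroup A] [Module S A] [AddCommGroup B] [Module S B]
    (f : A →ₗ[S] B), IsPureMono f → ∀ g : A →ₗ[S] M, ∃ h : B →ₗ[S] M, h ∘ₗ f = g

/-- `M` is Σ-pure injective: all direct sums `M^(I)` of copies of `M` are pure injective. -/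
def IsSigmaPureInjective (M : Type u) [AddCommGroup M] [Module S M] : Prop :=
  ∀ I : Type u, IsPureInjective S (I →₀ M)

end Modules

/-!
The passage from Σ-pure injectivity to `Add(M) ⊆ Prod(M)` is formal: the inclusion `M^(I) → M^I` is a
pure monomorphism, so it splits once `M^(I)` is pure injective.

The converse goes through the descending chain condition on pp-definable subgroups of `M`
(`PPFormula.HasDCC`), which passes to all `M^(I)` and implies pure injectivity: a homomorphism
defined on a pure submodule is extended by one element at a time
(`PreservesSystems.exists_sup_span`), the possible images of the new element forming a down-directed
family of cosets of pp-definable subgroups, which has a least member by the chain condition.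

To obtain the chain condition, choose `I` larger than `M` and `ℵ₀`, let `M^(I)` be a direct summand of
`M^J` with projection `f`, and suppose that `U 0 > U 1 > ⋯` are pp-definable. Call `X ⊆ J` negligible
if `f` maps `(U n)^X`, for some `n`, into `⋂ k, U k` outside finitely many coordinates. A diagonal
argument in the style of Chase (`exists_isNegligible`) shows that every point-finite sequence of
subsets of `J` has a negligible member. Hence the negligible sets form an ideal modulo which every
other set contains an atom, and an atom yields a countably additive two-valued measure on `J`. As
there are no measurable cardinals, the measure is concentrated at a point; it follows that a cofinite
subset of `J` is negligible (`IsDiagonalIdeal.exists_finite_compl`). Then a finite power of `M`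
distinguishes the elements with the single entry `u`, for all but finitely many positions in `I`, where
`u` lies in `U n` but not in `U (n + 1)`, contradicting the choice of `I` (`PPFormula.HasDCC.of_isDirectSummand`).
-/

/-! ### Diagonal ideals of sets and two-valued measures -/

/-- An ideal of subsets of `J` such that any sequence of subsets in which every point occurs only
finitely often meets the ideal. -/
structure IsDiagonalIdeal {J : Type u} (P : Set J → Prop) : Prop where
  mono : ∀ {s t : Set J}, s ⊆ t → P t → P s
  union : ∀ {s t : Set J}, P s → P t → P (s ∪ t)
  exists_mem : ∀ Y : ℕ → Set J, (∀ j, {k | j ∈ Y k}.Finite) → ∃ k, P (Y k)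

namespace IsDiagonalIdeal

variable {J : Type u} {P : Set J → Prop}

theorem empty (hP : IsDiagonalIdeal P) : P ∅ := by
  obtain ⟨k, hk⟩ := hP.exists_mem (fun _ => ∅) (by simp)
  exact hk

theorem biUnion_lt (hP : IsDiagonalIdeal P) {Y : ℕ → Set J} (hY : ∀ k, P (Y k)) (n : ℕ) :
    P (⋃ k < n, Y k) := by
  induction n with
  | zero => simpa using hP.empty
  | succ n ih =>
    rw [Set.biUnion_lt_succ]
    exact hP.union ih (hY n)

/-- A diagonal ideal is closed under countable disjoint unions: its defining property applies to the
tails `⋃ l ≥ k, Y l`. -/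
theorem iUnion (hP : IsDiagonalIdeal P) {Y : ℕ → Set J} (hY : ∀ k, P (Y k))
    (hd : Pairwise (Function.onFun Disjoint Y)) : P (⋃ k, Y k) := by
  obtain ⟨k, hk⟩ := hP.exists_mem (fun k => ⋃ l ≥ k, Y l) fun j => by
    by_cases hj : ∃ l, j ∈ Y l
    · obtain ⟨l, hl⟩ := hj
      refine (Set.finite_Iic l).subset fun k hk => ?_
      simp only [Set.mem_ofPred_eq, Set.mem_iUnion] at hk
      obtain ⟨l', hkl', hl'⟩ := hk
      have : l = l' := by
        by_contra hne
        exact Set.disjoint_left.1 (hd hne) hl hl'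
      exact this ▸ hkl'
    · refine Set.finite_empty.subset fun k hk => ?_
      simp only [Set.mem_ofPred_eq, Set.mem_iUnion] at hk
      obtain ⟨l', -, hl'⟩ := hk
      exact hj ⟨l', hl'⟩
  refine hP.mono ?_ (hP.union hk (hP.biUnion_lt hY k))
  intro j hj
  obtain ⟨l, hl⟩ := Set.mem_iUnion.1 hj
  rcases le_or_gt k l with h | h
  · exact Or.inl (Set.mem_biUnion h hl)
  · exact Or.inr (Set.mem_biUnion h hl)

theorem finite_singleton_notMem (hP : IsDiagonalIdeal P) : {j | ¬ P {j}}.Finite := by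
  by_contra hinf
  let e := Set.Infinite.natEmbedding _ hinf
  obtain ⟨k, hk⟩ := hP.exists_mem (fun k => {(e k : J)}) fun j => by
    refine Set.Subsingleton.finite fun k hk l hl => e.injective (Subtype.ext ?_)
    exact (Set.mem_singleton_iff.1 hk).symm.trans hl
  exact (e k).2 hk

/-- Modulo a diagonal ideal every set outside the ideal contains an atom; otherwise repeated
splitting would produce a disjoint sequence outside the ideal. -/
theorem exists_atom (hP : IsDiagonalIdeal P) {Y : Set J} (hY : ¬ P Y) :
    ∃ X ⊆ Y, ¬ P X ∧ ∀ s ⊆ X, P s ∨ P (X \ s) := by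
  have hwf : WellFounded fun s t : Set J => s ⊆ t ∧ ¬ P (t \ s) := by
    rw [wellFounded_iff_isEmpty_descending_chain]
    refine ⟨fun ⟨Z, hZ⟩ => ?_⟩
    have hanti : Antitone Z := antitone_nat_of_succ_le fun n => (hZ n).1
    obtain ⟨k, hk⟩ := hP.exists_mem (fun k => Z k \ Z (k + 1)) fun j => by
      refine Set.Subsingleton.finite fun k hk l hl => ?_
      by_contra hne
      rcases lt_or_gt_of_ne hne with h | h
      · exact hk.2 (hanti h hl.1)
      · exact hl.2 (hanti h hk.1)
    exact (hZ k).2 hk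
  obtain ⟨X, ⟨hXY, hX⟩, hmin⟩ := hwf.has_min {X | X ⊆ Y ∧ ¬ P X} ⟨Y, subset_rfl, hY⟩
  refine ⟨X, hXY, hX, fun s hs => ?_⟩
  by_contra! h
  exact hmin s ⟨hs.trans hXY, h.1⟩ ⟨hs, h.2⟩

open Classical in
/-- An atom `X` of the quotient by a diagonal ideal defines a countably additive measure on all
subsets of `J`: a set has measure `0` if its trace on `X` is in the ideal, and `1` otherwise. -/
theorem exists_measure (hP : IsDiagonalIdeal P) {X : Set J}
    (hX : ∀ s ⊆ X, P s ∨ P (X \ s)) :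
    ∃ μ : @MeasureTheory.Measure J ⊤, ∀ s, μ s = if P (s ∩ X) then 0 else 1 := by
  refine ⟨@MeasureTheory.Measure.ofMeasurable J ⊤ (fun s _ => if P (s ∩ X) then 0 else 1)
    (by simp [hP.empty]) ?_, fun s => @MeasureTheory.Measure.ofMeasurable_apply J ⊤ _ _ _ s trivial⟩
  intro Y _ hd
  by_cases hY : ∀ k, P (Y k ∩ X)
  · have : P ((⋃ k, Y k) ∩ X) := by
      rw [Set.iUnion_inter]
      exact hP.iUnion hY fun k l hkl =>
        (hd hkl).mono Set.inter_subset_left Set.inter_subset_left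
    simp [hY, this]
  · push Not at hY
    obtain ⟨k, hk⟩ := hY
    have hU : ¬ P ((⋃ k, Y k) ∩ X) := fun h =>
      hk (hP.mono (Set.inter_subset_inter_left _ (Set.subset_iUnion Y k)) h)
    rw [if_neg hU, tsum_eq_single k, if_neg hk]
    intro l hl
    refine if_pos (hP.mono ?_ ((hX (Y k ∩ X) Set.inter_subset_right).resolve_left hk))
    exact fun j hj => ⟨hj.2, fun h => Set.disjoint_left.1 (hd hl) hj.1 h.1⟩

/-- In the absence of measurable cardinals, a diagonal ideal contains a cofinite set: an atom of the
quotient carries a two-valued measure, which is then concentrated at a point outside the ideal. -/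
theorem exists_finite_compl (noMeasurable : ∀ κ : Cardinal.{u}, ¬ IsMeasurableCardinal κ)
    (hP : IsDiagonalIdeal P) : ∃ F : Set J, F.Finite ∧ P Fᶜ := by
  refine ⟨_, hP.finite_singleton_notMem, ?_⟩
  by_contra hY
  obtain ⟨X, hXY, hX, hatom⟩ := hP.exists_atom hY
  obtain ⟨μ, hμ⟩ := hP.exists_measure hatom
  have hsing : ∀ j, μ {j} = 0 := fun j => by
    rw [hμ, if_pos]
    by_cases hj : j ∈ X
    · exact hP.mono Set.inter_subset_left (not_not.1 (hXY hj))
    · rw [Set.singleton_inter_eq_empty.2 hj]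
      exact hP.empty
  have huniv : μ Set.univ = 1 := by rw [hμ, Set.univ_inter, if_neg hX]
  refine noMeasurable (Cardinal.mk J) ⟨?_, J, rfl, μ, fun s => ?_, huniv, hsing⟩
  · by_contra hle
    have : Countable J := Cardinal.mk_le_aleph0_iff.1 (not_lt.1 hle)
    have h0 : μ (⋃ j : J, {j}) = 0 := 
      MeasureTheory.measure_iUnion_null hsing
    rw [Set.iUnion_of_singleton, huniv] at h0
    exact one_ne_zero h0
  · rw [hμ]
    split_ifs <;> simp

end IsDiagonalIdeal

/-! ### Positive primitive formulas -/

/-- A positive primitive formula in one free variable `x` over `S`, with parameters left open: the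
finite linear system `param i • x + ∑ j, coeff i j • y j = a i`, in which the `y j` are
existentially quantified and the right-hand sides `a i` are supplied later. -/
structure PPFormula (S : Type u) where
  /-- The index type of the equations. -/
  rows : Type
  /-- The index type of the bound variables. -/
  cols : Type
  [fintypeRows : Fintype rows]
  [fintypeCols : Fintype cols]
  /-- The coefficients of the free variable. -/
  param : rows → S
  /-- The coefficients of the bound variables. -/
  coeff : rows → cols → S

namespace PPFormula

attribute [instance] fintypeRows fintypeCols

variable {S : Type u} [Ring S]

/-- The elements `x` of `N` satisfying the formula with right-hand sides `a`. -/
def Holds (p : PPFormula S) {N : Type u} [AddCommGroup N] [Module S N] (a : p.rows → N) (x : N) :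
    Prop :=
  ∃ y : p.cols → N, ∀ i, p.param i • x + ∑ j, p.coeff i j • y j = a i

section Module

variable (p q : PPFormula S) {N N' : Type u} [AddCommGroup N] [Module S N]
  [AddCommGroup N'] [Module S N']

variable {p} in
theorem Holds.add {a b : p.rows → N} {x y : N} (hx : p.Holds a x) (hy : p.Holds b y) :
    p.Holds (a + b) (x + y) := by
  obtain ⟨u, hu⟩ := hx
  obtain ⟨v, hv⟩ := hy
  refine ⟨u + v, fun i => ?_⟩
  simp only [Pi.add_apply, smul_add, Finset.sum_add_distrib, ← hu, ← hv]
  abel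

variable {p} in
theorem Holds.neg {a : p.rows → N} {x : N} (hx : p.Holds a x) : p.Holds (-a) (-x) := by
  obtain ⟨u, hu⟩ := hx
  refine ⟨-u, fun i => ?_⟩
  simp only [Pi.neg_apply, smul_neg, Finset.sum_neg_distrib, ← hu]
  abel

variable (N) in
/-- The pp-definable subgroup (finite matrix subgroup) of `N`: the elements satisfying the
homogeneous formula. It need not be a submodule, as `S` need not be commutative. -/
def subgroup : AddSubgroup N where
  carrier := {x | p.Holds 0 x}
  zero_mem' := ⟨0, by simp⟩
  add_mem' hx hy := by simpa using Holds.add hx hy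
  neg_mem' hx := by simpa using Holds.neg hx

theorem mem_subgroup {x : N} : x ∈ p.subgroup N ↔ p.Holds 0 x := Iff.rfl

theorem map_mem_subgroup (f : N →ₗ[S] N') {x : N} (hx : x ∈ p.subgroup N) :
    f x ∈ p.subgroup N' := by
  obtain ⟨y, hy⟩ := hx
  exact ⟨f ∘ y, fun i => by simpa using congrArg f (hy i)⟩

theorem mem_subgroup_pi {I : Type u} {x : I → N} :
    x ∈ p.subgroup (I → N) ↔ ∀ i, x i ∈ p.subgroup N := by
  refine ⟨fun h i => p.map_mem_subgroup (LinearMap.proj i) h, fun h => ?_⟩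
  choose y hy using h
  exact ⟨fun j i => y i j, fun r => funext fun i => by simpa using hy i r⟩

theorem mem_subgroup_finsupp {I : Type u} {x : I →₀ N} :
    x ∈ p.subgroup (I →₀ N) ↔ ∀ i, x i ∈ p.subgroup N := by
  refine ⟨fun h i => p.map_mem_subgroup (Finsupp.lapply i) h, fun h => ?_⟩
  rw [← x.sum_single]
  exact sum_mem fun i _ => p.map_mem_subgroup (Finsupp.lsingle i) (h i)

/-- The conjunction of two formulas. -/
def and : PPFormula S where
  rows := p.rows ⊕ q.rows
  cols := p.cols ⊕ q.cols
  param := Sum.elim p.param q.param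
  coeff := Sum.elim (fun i => Sum.elim (p.coeff i) 0) (fun i => Sum.elim 0 (q.coeff i))

theorem holds_and {a : p.rows ⊕ q.rows → N} {x : N} :
    (p.and q).Holds a x ↔
      p.Holds (fun i => a (Sum.inl i)) x ∧ q.Holds (fun i => a (Sum.inr i)) x := by
  -- `erw`, because `(p.and q).cols` is a sum type only after unfolding `and`.
  constructor
  · rintro ⟨y, hy⟩
    refine ⟨⟨fun j => y (Sum.inl j), fun i => ?_⟩, ⟨fun j => y (Sum.inr j), fun i => ?_⟩⟩
    · have := hy (Sum.inl i)
      erw [Fintype.sum_sum_type] at this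
      simpa [and] using this
    · have := hy (Sum.inr i)
      erw [Fintype.sum_sum_type] at this
      simpa [and] using this
  · rintro ⟨⟨y, hy⟩, ⟨z, hz⟩⟩
    refine ⟨(Sum.elim y z : p.cols ⊕ q.cols → N), ?_⟩
    rintro (i | i)
    · erw [Fintype.sum_sum_type]
      simpa [and] using hy i
    · erw [Fintype.sum_sum_type]
      simpa [and] using hz i

theorem mem_subgroup_and {x : N} :
    x ∈ (p.and q).subgroup N ↔ x ∈ p.subgroup N ∧ x ∈ q.subgroup N :=
  p.holds_and q

end Module

/-- The descending chain condition on pp-definable subgroups of `N`. -/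
def HasDCC (S N : Type u) [Ring S] [AddCommGroup N] [Module S N] : Prop :=
  WellFounded fun p q : PPFormula S => p.subgroup N < q.subgroup N

theorem HasDCC.finsupp {N : Type u} [AddCommGroup N] [Module S N] (h : HasDCC S N) (I : Type u) :
    HasDCC S (I →₀ N) := by
  refine h.mono fun p q hpq => ?_
  obtain ⟨hle, x, hxq, hxp⟩ := SetLike.lt_iff_le_and_exists.1 hpq
  rw [mem_subgroup_finsupp] at hxq hxp
  push Not at hxp
  obtain ⟨i, hi⟩ := hxp
  refine SetLike.lt_iff_le_and_exists.2 ⟨fun z hz => ?_, x i, hxq i, hi⟩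
  simpa using q.mem_subgroup_finsupp.1 (hle (p.map_mem_subgroup (Finsupp.lsingle i) hz)) i

end PPFormula

/-! ### The descending chain condition implies pure injectivity -/

section PureInjective

variable {S : Type u} [Ring S] {B N : Type u} [AddCommGroup B] [Module S B]
  [AddCommGroup N] [Module S N]

/-- A submodule `Γ` of `B × N`, thought of as the graph of a partial map `B → N`, preserves systems
if every finite linear system with constants in the domain that is solvable in `B` is solvable in
`N` once the constants are replaced by their images. Single-valuedness of `Γ` is the special case of
the system `0 = 0`. -/
def PreservesSystems (Γ : Submodule S (B × N)) : Prop :=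
  ∀ (ρ κ : Type) [Fintype ρ] [Fintype κ] (c : ρ → κ → S) (a : ρ → B × N), (∀ i, a i ∈ Γ) →
    (∃ y : κ → B, ∀ i, ∑ j, c i j • y j = (a i).1) → ∃ x : κ → N, ∀ i, ∑ j, c i j • x j = (a i).2

theorem PreservesSystems.eq_zero {Γ : Submodule S (B × N)} (h : PreservesSystems Γ) {x : N}
    (hx : ((0 : B), x) ∈ Γ) : x = 0 := by
  obtain ⟨y, hy⟩ := h Unit Empty (fun _ j => j.elim) (fun _ => (0, x)) (fun _ => hx)
    ⟨fun j => j.elim, by simp⟩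
  simpa using (hy ()).symm

theorem IsPureMono.preservesSystems {A : Type u} [AddCommGroup A] [Module S A] {f : A →ₗ[S] B}
    (hf : IsPureMono f) (g : A →ₗ[S] N) : PreservesSystems (LinearMap.range (f.prod g)) := by
  intro ρ κ _ _ c a ha ⟨y, hy⟩
  choose b hb using ha
  let eρ := Fintype.equivFin ρ
  let eκ := Fintype.equivFin κ
  obtain ⟨x, hx⟩ := hf.2 _ _ (fun i j => c (eρ.symm i) (eκ.symm j)) (fun i => b (eρ.symm i))
    ⟨fun j => y (eκ.symm j), fun i => by
      rw [eκ.symm.sum_comp (fun j => c (eρ.symm i) j • y j), hy, ← hb]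
      rfl⟩
  refine ⟨fun j => g (x (eκ j)), fun i => ?_⟩
  have := hx (eρ i)
  simp only [Equiv.symm_apply_apply] at this
  rw [← hb]
  change _ = g _
  rw [← this, map_sum, ← eκ.symm.sum_comp (fun j => c i j • g (x (eκ j)))]
  simp

/-- Preservation of systems passes to unions of chains, as a system involves only finitely many
constants. -/
theorem preservesSystems_sSup {c : Set (Submodule S (B × N))} (hne : c.Nonempty)
    (hc : IsChain (· ≤ ·) c) (h : ∀ Γ ∈ c, PreservesSystems Γ) : PreservesSystems (sSup c) := by
  intro ρ κ _ _ C a ha hy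
  have hdir := hc.directedOn
  have hmem : ∀ i, ∃ Γ ∈ c, a i ∈ Γ := fun i =>
    (Submodule.mem_sSup_of_directed hne hdir).1 (ha i)
  choose Γ hΓ haΓ using hmem
  have hub : ∃ Δ ∈ c, ∀ i, Γ i ≤ Δ := by
    have : Nonempty c := hne.to_subtype
    obtain ⟨Δ, hΔ⟩ := hdir.directed_val.finite_le (fun i : ρ => (⟨Γ i, hΓ i⟩ : c))
    exact ⟨Δ, Δ.2, hΔ⟩
  obtain ⟨Δ, hΔ, hle⟩ := hub
  exact h Δ hΔ ρ κ C a (fun i => hle i (haΓ i)) hy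

/-- A system-preserving partial map extends to any further element `b`: the sets of candidates for
the image of `b` cut out by the systems satisfied by `b` are cosets of pp-definable subgroups, they
form a down-directed family, and by the descending chain condition a smallest one exists. -/
theorem PreservesSystems.exists_sup_span (hN : PPFormula.HasDCC S N)
    {Γ : Submodule S (B × N)} (h : PreservesSystems Γ) (b : B) :
    ∃ m : N, PreservesSystems (Γ ⊔ Submodule.span S {(b, m)}) := by
  let T : Set (PPFormula S) := {p | ∃ a : p.rows → B × N, (∀ i, a i ∈ Γ) ∧
    p.Holds (fun i => (a i).1) b}
  have hsol : ∀ (p : PPFormula S) (a : p.rows → B × N), (∀ i, a i ∈ Γ) →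
      p.Holds (fun i => (a i).1) b → ∃ m, p.Holds (fun i => (a i).2) m := by
    rintro p a ha ⟨y, hy⟩
    obtain ⟨x, hx⟩ := h p.rows (Option p.cols) (fun i j => j.elim (p.param i) (p.coeff i)) a ha
      ⟨fun j => j.elim b y, fun i => by simpa [Fintype.sum_option] using hy i⟩
    exact ⟨x none, fun j => x (some j), fun i => by simpa [Fintype.sum_option] using hx i⟩
  -- The system without equations shows that `T` is nonempty.
  let triv : PPFormula S := ⟨Empty, Empty, fun i => i.elim, fun i => i.elim⟩
  obtain ⟨p, ⟨a, ha, hpb⟩, hmin⟩ := hN.has_min T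
    ⟨triv, fun i => Empty.elim i, fun i => Empty.elim i, fun i => Empty.elim i,
      fun i => Empty.elim i⟩
  obtain ⟨m, hm⟩ := hsol p a ha hpb
  have key : ∀ (q : PPFormula S) (d : q.rows → B × N), (∀ i, d i ∈ Γ) →
      q.Holds (fun i => (d i).1) b → q.Holds (fun i => (d i).2) m := by
    intro q d hd hqb
    have hand : (p.and q).Holds (fun i => ((Sum.elim a d : p.rows ⊕ q.rows → B × N) i).1) b :=
      (p.holds_and q).2 ⟨hpb, hqb⟩
    have had : ∀ i, (Sum.elim a d : p.rows ⊕ q.rows → B × N) i ∈ Γ := by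
      rintro (i | i)
      exacts [ha i, hd i]
    obtain ⟨m', hm'⟩ := hsol (p.and q) (Sum.elim a d : p.rows ⊕ q.rows → B × N) had hand
    have hm'' : p.Holds (fun i => (a i).2) m' ∧ q.Holds (fun i => (d i).2) m' :=
      (p.holds_and q).1 hm'
    have hle : (p.and q).subgroup N ≤ p.subgroup N := fun x hx => ((p.mem_subgroup_and q).1 hx).1
    have heq : (p.and q).subgroup N = p.subgroup N := by
      by_contra hne
      exact hmin _ ⟨_, had, hand⟩ (lt_of_le_of_ne hle hne)
    have hdiff : m - m' ∈ p.subgroup N := by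
      rw [PPFormula.mem_subgroup, sub_eq_add_neg]
      simpa using hm.add hm''.1.neg
    have hdiff' : m - m' ∈ q.subgroup N := by
      rw [← heq] at hdiff
      exact ((p.mem_subgroup_and q).1 hdiff).2
    simpa using hdiff'.add hm''.2
  refine ⟨m, fun ρ κ _ _ c e he ⟨y, hy⟩ => ?_⟩
  have hdec : ∀ i, ∃ d ∈ Γ, ∃ s : S, d + s • (b, m) = e i := fun i => by
    obtain ⟨d, hd, z, hz, hdz⟩ := Submodule.mem_sup.1 (he i)
    obtain ⟨s, rfl⟩ := Submodule.mem_span_singleton.1 hz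
    exact ⟨d, hd, s, hdz⟩
  choose d hd s hs using hdec
  obtain ⟨x, hx⟩ := key ⟨ρ, κ, fun i => -s i, c⟩ d hd ⟨y, fun i => by
    change -s i • b + ∑ j, c i j • y j = _
    rw [hy, ← hs]
    simp⟩
  refine ⟨x, fun i => ?_⟩
  have := hx i
  change -s i • m + ∑ j, c i j • x j = (d i).2 at this
  rw [← hs, Prod.snd_add, ← this]
  simp

theorem PPFormula.HasDCC.isPureInjective (hN : PPFormula.HasDCC S N) : IsPureInjective S N := by
  intro A B _ _ _ _ f hf g
  obtain ⟨Γ, hle, hΓ, hmax⟩ := zorn_le_nonempty₀ {Γ : Submodule S (B × N) | PreservesSystems Γ}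
    (fun c hcs hc Γ hΓ => ⟨sSup c, preservesSystems_sSup ⟨Γ, hΓ⟩ hc hcs, fun _ => le_sSup⟩)
    _ (hf.preservesSystems g)
  have hex : ∀ b, ∃ m, (b, m) ∈ Γ := fun b => by
    obtain ⟨m, hm⟩ := PreservesSystems.exists_sup_span hN hΓ b
    exact ⟨m, hmax hm le_sup_left (Submodule.mem_sup_right (Submodule.mem_span_singleton_self _))⟩
  choose h hh using hex
  have huniq : ∀ {b m}, (b, m) ∈ Γ → h b = m := fun {b m} hm => by
    have := Γ.sub_mem (hh b) hm
    rw [Prod.mk_sub_mk, sub_self] at this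
    exact sub_eq_zero.1 (PreservesSystems.eq_zero hΓ this)
  refine ⟨{ toFun := h
            map_add' := fun x y => huniq (Γ.add_mem (hh x) (hh y))
            map_smul' := fun s x => huniq (Γ.smul_mem s (hh x)) }, LinearMap.ext fun a => ?_⟩
  exact huniq (hle ⟨a, rfl⟩)

theorem PPFormula.HasDCC.isSigmaPureInjective (hN : PPFormula.HasDCC S N) :
    IsSigmaPureInjective S N :=
  fun I => (hN.finsupp I).isPureInjective

end PureInjective

/-! ### Direct summands -/

section Summand

variable {S : Type u} [Ring S] {N X Y : Type u} [AddCommGroup N] [Module S N]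
  [AddCommGroup X] [Module S X] [AddCommGroup Y] [Module S Y]

theorem isDirectSummand_iff_exists_retraction :
    IsDirectSummand S N X ↔ ∃ (s : N →ₗ[S] X) (r : X →ₗ[S] N), r ∘ₗ s = LinearMap.id := by
  constructor
  · rintro ⟨A, B, hAB, ⟨e⟩⟩
    refine ⟨A.subtype ∘ₗ e, e.symm ∘ₗ A.projectionOnto B hAB, LinearMap.ext fun x => ?_⟩
    simp
  · rintro ⟨s, r, hrs⟩
    have hrs' : ∀ x, r (s x) = x := fun x => LinearMap.congr_fun hrs x
    have hinj : Function.Injective s := Function.LeftInverse.injective hrs'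
    refine ⟨LinearMap.range s, LinearMap.ker (s.rangeRestrict ∘ₗ r),
      LinearMap.isCompl_of_proj ?_, ⟨LinearEquiv.ofInjective s hinj⟩⟩
    rintro ⟨_, x, rfl⟩
    exact Subtype.ext (by simp [hrs'])

theorem IsDirectSummand.trans (h : IsDirectSummand S N X) (h' : IsDirectSummand S X Y) :
    IsDirectSummand S N Y := by
  rw [isDirectSummand_iff_exists_retraction] at *
  obtain ⟨s, r, h⟩ := h
  obtain ⟨s', r', h'⟩ := h'
  refine ⟨s' ∘ₗ s, r ∘ₗ r', LinearMap.ext fun x => ?_⟩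
  have h1 := LinearMap.congr_fun h' (s x)
  have h2 := LinearMap.congr_fun h x
  simp only [LinearMap.comp_apply, LinearMap.id_apply] at *
  rw [h1, h2]

/-- A direct sum is a pure submodule of the direct product: a solution of a system in the product
can be cut off outside the finite union of the supports of the constants. -/
theorem isPureMono_lcoeFun (I : Type u) :
    IsPureMono (Finsupp.lcoeFun : (I →₀ N) →ₗ[S] I → N) := by
  classical
  refine ⟨DFunLike.coe_injective, fun m n c a ⟨y, hy⟩ => ?_⟩
  let F : Finset I := Finset.univ.biUnion fun i => (a i).support
  refine ⟨fun j => Finsupp.indicator F fun i _ => y j i, fun k => Finsupp.ext fun i => ?_⟩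
  have hk := congrFun (hy k) i
  simp only [Finset.sum_apply, Pi.smul_apply, Finsupp.lcoeFun_apply] at hk
  by_cases hi : i ∈ F
  · simp [Finsupp.finsetSum_apply, Finsupp.indicator_apply, hi, hk]
  · have : a k i = 0 := by
      by_contra hne
      exact hi (Finset.mem_biUnion.2 ⟨k, Finset.mem_univ k, Finsupp.mem_support_iff.2 hne⟩)
    simp [Finsupp.finsetSum_apply, Finsupp.indicator_apply, hi, this]

theorem IsSigmaPureInjective.addClass_subset_prodClass (h : IsSigmaPureInjective S N) :
    addClass S N ⊆ prodClass S N := by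
  rintro X ⟨I, hX⟩
  obtain ⟨r, hr⟩ := h I _ _ _ (isPureMono_lcoeFun I) LinearMap.id
  exact ⟨I, hX.trans (isDirectSummand_iff_exists_retraction.2 ⟨_, r, hr⟩)⟩

end Summand

/-! ### Homomorphisms from products to direct sums -/

section Chase

variable {S : Type u} [Ring S] {M : Type u} [AddCommGroup M] [Module S M] {I J : Type u}

/-- For a homomorphism `f : M^J → M^(I)` and a sequence `p` of formulas defining subgroups `U n`, a
set `X ⊆ J` is negligible if, for some `n`, all coordinates outside a fixed finite set of `f x` lie
in `⋂ k, U k` for every `x ∈ (U n)^J` supported on `X`. -/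
def IsNegligible (f : (J → M) →ₗ[S] (I →₀ M)) (p : ℕ → PPFormula S) (X : Set J) : Prop :=
  ∃ (n : ℕ) (F : Finset I), ∀ x : J → M, (∀ j ∉ X, x j = 0) →
    (∀ j, x j ∈ (p n).subgroup M) → ∀ i ∉ F, ∀ k, f x i ∈ (p k).subgroup M

variable (f : (J → M) →ₗ[S] (I →₀ M)) {p : ℕ → PPFormula S}

theorem map_apply_mem_subgroup {q : PPFormula S} {x : J → M} (hx : ∀ j, x j ∈ q.subgroup M)
    (i : I) : f x i ∈ q.subgroup M :=
  q.mem_subgroup_finsupp.1 (q.map_mem_subgroup f (q.mem_subgroup_pi.2 hx)) i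

/-- Chase's diagonal argument: if no member of a point-finite sequence of subsets of `J` is
negligible, there are `x k ∈ M^J` supported on them and pairwise distinct indices `i k` such that
the sum of the `x k` is mapped by `f` to an element with nonzero coordinate at every `i k`. -/
theorem exists_isNegligible (hp : Antitone fun n => (p n).subgroup M) (Y : ℕ → Set J)
    (hY : ∀ j, {k | j ∈ Y k}.Finite) : ∃ k, IsNegligible f p (Y k) := by
  classical
  by_contra! H
  simp only [IsNegligible, not_exists, not_forall, exists_prop] at H
  choose x hxsupp hxmem i hiF n' hn' using H
  -- At stage `k` the state consists of a level `n` and the indices in the supports of the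
  -- images of the elements chosen so far.
  let st : ℕ → ℕ × Finset I := fun k => Nat.rec (0, ∅)
    (fun k s => (max s.1 (n' k s.1 s.2), s.2 ∪ (f (x k s.1 s.2)).support)) k
  let X : ℕ → J → M := fun k => x k (st k).1 (st k).2
  let ι : ℕ → I := fun k => i k (st k).1 (st k).2
  have hst1 : Monotone fun k => (st k).1 := monotone_nat_of_le_succ fun k => le_max_left _ _
  have hst2 : Monotone fun k => (st k).2 := monotone_nat_of_le_succ fun k =>
    Finset.subset_union_left
  have hXι : ∀ k, f (X k) (ι k) ∉ (p (st (k + 1)).1).subgroup M := fun k h =>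
    hn' k (st k).1 (st k).2 (hp (le_max_right _ _) h)
  have hXι0 : ∀ k, f (X k) (ι k) ≠ 0 := fun k h => hXι k (h ▸ zero_mem _)
  have hzero : ∀ l k, l < k → f (X l) (ι k) = 0 := fun l k hlk => by
    by_contra hne
    refine hiF k (st k).1 (st k).2 (hst2 (Nat.succ_le_of_lt hlk) ?_)
    exact Finset.mem_union_right _ (Finsupp.mem_support_iff.2 hne)
  have hinj : Function.Injective ι := Function.Injective.of_lt_imp_ne fun l k hlk h =>
    hXι0 l (h ▸ hzero l k hlk)
  let z : J → M := fun j => ∑ k ∈ (hY j).toFinset, X k j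
  have htail : ∀ k j, (z - ∑ l ∈ Finset.range (k + 1), X l) j ∈
      (p (st (k + 1)).1).subgroup M := fun k j => by
    have hz : z j = ∑ l ∈ (hY j).toFinset ∪ Finset.range (k + 1), X l j :=
      Finset.sum_subset Finset.subset_union_left fun l _ hl =>
        hxsupp l _ _ j fun h => hl ((hY j).mem_toFinset.2 h)
    rw [Pi.sub_apply, Finset.sum_apply, hz,
      ← Finset.sum_sdiff (Finset.subset_union_right : Finset.range (k + 1) ⊆ _), add_sub_cancel_right]
    refine sum_mem fun l hl => ?_
    have hkl : k + 1 ≤ l := by simpa using (Finset.mem_sdiff.1 hl).2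
    exact hp (hst1 hkl) (hxmem l _ _ j)
  have hne : ∀ k, f z (ι k) ≠ 0 := fun k h0 => by
    refine hXι k ?_
    have h := neg_mem (map_apply_mem_subgroup f (htail k) (ι k))
    rw [map_sub, map_sum, Finsupp.sub_apply, h0, zero_sub, neg_neg, Finsupp.finsetSum_apply,
      Finset.sum_range_succ, Finset.sum_eq_zero, zero_add] at h
    · exact h
    · exact fun l hl => hzero l k (Finset.mem_range.1 hl)
  exact Set.infinite_range_of_injective hinj ((f z).support.finite_toSet.subset
    (Set.range_subset_iff.2 fun k => Finsupp.mem_support_iff.2 (hne k)))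

theorem isDiagonalIdeal_isNegligible (hp : Antitone fun n => (p n).subgroup M) :
    IsDiagonalIdeal (IsNegligible f p) where
  mono := fun {s t} hst ⟨n, F, h⟩ =>
    ⟨n, F, fun x hx => h x fun j hj => hx j fun hs => hj (hst hs)⟩
  union := by
    classical
    rintro s t ⟨n₁, F₁, h₁⟩ ⟨n₂, F₂, h₂⟩
    refine ⟨max n₁ n₂, F₁ ∪ F₂, fun x hx hmem i hi k => ?_⟩
    rw [Finset.notMem_union] at hi
    have hs := h₁ (s.indicator x) (fun j hj => Set.indicator_of_notMem hj x)
      (fun j => by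
        by_cases hj : j ∈ s
        · rw [Set.indicator_of_mem hj]
          exact hp (le_max_left _ _) (hmem j)
        · rw [Set.indicator_of_notMem hj]
          exact zero_mem _) i hi.1 k
    have ht := h₂ (sᶜ.indicator x) (fun j hj => by
        by_cases hjs : j ∈ s
        · exact Set.indicator_of_notMem (Set.notMem_compl_iff.2 hjs) x
        · rw [Set.indicator_of_mem (Set.mem_compl hjs), hx j fun h => Or.elim h hjs hj])
      (fun j => by
        by_cases hj : j ∈ sᶜ
        · rw [Set.indicator_of_mem hj]
          exact hp (le_max_right _ _) (hmem j)
        · rw [Set.indicator_of_notMem hj]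
          exact zero_mem _) i hi.2 k
    have := add_mem hs ht
    rwa [← Finsupp.add_apply, ← map_add, Set.indicator_self_add_compl] at this
  exists_mem := exists_isNegligible f hp

/-- If `M^(I)` is a direct summand of a power of `M` for a sufficiently large `I`, then `M` has the
descending chain condition on pp-definable subgroups. Given a strictly descending chain and `u` in
`U n` but not in `U (n + 1)`, with `n` a level at which a cofinite subset of `J` is negligible, the
elements `single i u` of `M^(I)` have, for all but finitely many `i`, distinct images in the remaining
finite power of `M`, which is smaller than `I`. -/
theorem PPFormula.HasDCC.of_isDirectSummand
    (noMeasurable : ∀ κ : Cardinal.{u}, ¬ IsMeasurableCardinal κ)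
    (hI : max (Cardinal.mk M) Cardinal.aleph0 < Cardinal.mk I)
    (h : IsDirectSummand S (I →₀ M) (J → M)) : PPFormula.HasDCC S M := by
  classical
  obtain ⟨s, f, hfs⟩ := isDirectSummand_iff_exists_retraction.1 h
  rw [PPFormula.HasDCC, wellFounded_iff_isEmpty_descending_chain]
  refine ⟨fun ⟨p, hpst⟩ => ?_⟩
  have hp : Antitone fun n => (p n).subgroup M := antitone_nat_of_succ_le fun n => (hpst n).le
  obtain ⟨G, hG, n, F, hneg⟩ :=
    (isDiagonalIdeal_isNegligible f hp).exists_finite_compl noMeasurable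
  obtain ⟨u, hu, hu'⟩ := (SetLike.lt_iff_le_and_exists.1 (hpst n)).2
  have : Infinite I := Cardinal.infinite_iff.2 ((le_max_right _ _).trans hI.le)
  have : Finite G := hG
  have hFlt : Cardinal.mk (F : Set I) < Cardinal.mk I :=
    (Cardinal.mk_lt_aleph0 (α := (F : Set I))).trans_le (Cardinal.aleph0_le_mk I)
  have hcard : Cardinal.mk (G → M) < Cardinal.mk ((F : Set I)ᶜ : Set I) := by
    rw [Cardinal.mk_compl_of_infinite _ hFlt]
    refine lt_of_le_of_lt ?_ hI
    obtain ⟨m, hm⟩ := Cardinal.lt_aleph0.1 (Cardinal.mk_lt_aleph0 (α := G))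
    rw [← Cardinal.power_def, hm]
    exact Cardinal.power_nat_le_max
  let y : I → J → M := fun i => s (Finsupp.single i u)
  have hy : ∀ i j, y i j ∈ (p n).subgroup M := fun i =>
    (p n).mem_subgroup_pi.1 ((p n).map_mem_subgroup (s ∘ₗ Finsupp.lsingle i) hu)
  have hninj : ¬ Function.Injective
      fun (i : ((F : Set I)ᶜ : Set I)) (j : G) => y i j :=
    fun hinj => hcard.not_ge (Cardinal.mk_le_of_injective hinj)
  simp only [Function.Injective, not_forall] at hninj
  obtain ⟨i, i', heq, hne⟩ := hninj
  have hmem := hneg (y i - y i') (fun j hj => by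
      have := congrFun heq ⟨j, not_not.1 hj⟩
      exact sub_eq_zero.2 this)
    (fun j => sub_mem (hy i j) (hy i' j)) i (fun h => i.2 (Finset.mem_coe.2 h)) (n + 1)
  have hfy : ∀ i, f (y i) = Finsupp.single i u := fun i => LinearMap.congr_fun hfs _
  rw [map_sub, hfy, hfy, Finsupp.sub_apply, Finsupp.single_eq_same,
    Finsupp.single_eq_of_ne (fun h => hne (Subtype.ext h)), sub_zero] at hmem
  exact hu' hmem

end Chase

/-! ### The characterization of Σ-pure injectivity -/

/-- Right `R`-modules are modules over `Rᵐᵒᵖ`. -/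
theorem theorem1p1 (noMeasurable : ∀ κ : Cardinal.{u}, ¬ IsMeasurableCardinal κ)
    (R : Type u) [Ring R] (M : Type u) [AddCommGroup M] [Module Rᵐᵒᵖ M] :
    addClass Rᵐᵒᵖ M ⊆ prodClass Rᵐᵒᵖ M ↔ IsSigmaPureInjective Rᵐᵒᵖ M := by
  refine ⟨fun h => ?_, IsSigmaPureInjective.addClass_subset_prodClass⟩
  -- Any index set larger than both `M` and `ℵ₀` works: every finite power of `M` is smaller.
  let I : Type u := (Order.succ (max (Cardinal.mk M) Cardinal.aleph0)).out
  obtain ⟨J, hJ⟩ := h (show ModuleCat.of Rᵐᵒᵖ (I →₀ M) ∈ addClass Rᵐᵒᵖ M from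
    ⟨I, isDirectSummand_iff_exists_retraction.2
      ⟨LinearMap.id, LinearMap.id, LinearMap.id_comp _⟩⟩)
  refine (PPFormula.HasDCC.of_isDirectSummand noMeasurable ?_ hJ).isSigmaPureInjective
  rw [Cardinal.mk_out]
  exact Order.lt_succ _
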